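/- A Feynman diagram of degree $m$ consists of an oriented circle (the Wilson loop) together with a finite graph with $2m$ vertices, each of which is univalent or trivalent, such that the three edges meeting at each trivalent vertex are cyclically ordered, the univalent vertices (legs) are placed at distinct points of the circle, and every connected component of the graph has at least one leg. Diagrams are considered up to isomorphism of the graph preserving the cyclic orders at the trivalent vertices and the cyclic order of the legs along the oriented circle. A chord diagram is a Feynman diagram without trivalent vertices. Let $\mathcal A_m$ be the complex vector space spanned by the Feynman diagrams of degree $m$ modulo the STU relations $S=T-U$: here $S$ has an edge joining the Wilson loop to a trivalent vertex whose half-edges are, in cyclic order, $a,b,c$, with $a$ belonging to that edge; $T$ and $U$ are obtained from $S$ by removing this edge and the trivalent vertex and attaching $b$ and $c$ to the Wilson loop at adjacent points in the place where the removed edge ended, in the order $c,b$ along the oriented loop for $T$ and in the order $b,c$ for $U$. Let $n\ge 1$ and $m\ge 0$. The $n$-th cabling operator is the linear map $\psi^n_m:\mathcal A_m\to\mathcal A_m$ which sends each chord diagram to the sum, over all $n^{2m}$ ways of lifting the $2m$ ends of its chords to the $n$ sheets of the $n$-fold cyclic cover of the Wilson loop, of the resulting chord diagram on the covering circle; there is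 exactly one linear map with this property. Theorem 3. Let $v$ be a Feynman diagram of degree $m$ with $p$ legs, and let $\mathrm{Sym}_v=\sum_{\sigma\in S_p}\sigma(v)\in\mathcal A_m$ be the sum, over all permutations $\sigma$ of the legs, of the diagrams obtained from $v$ by permuting the positions of the legs on the Wilson loop by $\sigma$. Then $$\psi^n_m\,\mathrm{Sym}_v=n^p\,\mathrm{Sym}_v .$$ -/

import Mathlib

/-- A Feynman diagram whose graph has `2 * m` vertices, `p` of which are univalent, drawn with
a marked point (a break) on its oriented Wilson loop.  The graph is given by its half-edges:
* `edge` is the fixed-point-free involution exchanging the two halves of an edge;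
* the vertices are the orbits of `vert`, which all have size 1 (univalent vertices) or 3
  (trivalent vertices, `vert` being the cyclic order of the three incoming half-edges);
* `leg` lists the univalent vertices (identified with their unique half-edge) in the order in
  which they are met on the Wilson loop, starting from the break;
* every component of the graph is attached to the Wilson loop.
Different labels of the half-edges and different breaks are identified later, by `Iso`. -/
structure FeynmanDiagram (m p : ℕ) where
  /-- the half-edges of the graph -/
  H : Type
  finite_H : Finite H
  edge : Equiv.Perm H
  edge_edge : ∀ h, edge (edge h) = h
  edge_ne : ∀ h, edge h ≠ h
  vert : Equiv.Perm H
  vert_vert_vert : ∀ h, vert (vert (vert h)) = h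
  card_vertices : Nat.card (Quotient (Equiv.Perm.SameCycle.setoid vert)) = 2 * m
  leg : Fin p → H
  leg_injective : Function.Injective leg
  leg_range : ∀ h, vert h = h ↔ ∃ i, leg i = h
  attached : ∀ h, ∃ i, Relation.ReflTransGen (fun x y => y = edge x ∨ y = vert x) h (leg i)

namespace FeynmanDiagram

variable {m p : ℕ}

/-- A chord diagram is a Feynman diagram without trivalent vertices. -/
def IsChordDiagram (v : FeynmanDiagram m p) : Prop := ∀ h, v.vert h = h

/-- The diagram with the same graph whose legs are placed on the (broken) Wilson loop in the
order `leg (σ 0), leg (σ 1), …`. -/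
def permute (v : FeynmanDiagram m p) (σ : Equiv.Perm (Fin p)) : FeynmanDiagram m p where
  H := v.H
  finite_H := v.finite_H
  edge := v.edge
  edge_edge := v.edge_edge
  edge_ne := v.edge_ne
  vert := v.vert
  vert_vert_vert := v.vert_vert_vert
  card_vertices := v.card_vertices
  leg := v.leg ∘ σ
  leg_injective := v.leg_injective.comp σ.injective
  leg_range h := (v.leg_range h).trans
    ⟨fun ⟨i, hi⟩ => ⟨σ.symm i, by simpa using hi⟩, fun ⟨i, hi⟩ => ⟨σ i, hi⟩⟩
  attached h := by
    obtain ⟨i, hi⟩ := v.attached h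
    exact ⟨σ.symm i, by simpa using hi⟩

/-- Two broken diagrams represent the same Feynman diagram: there is an isomorphism of graphs
which respects the cyclic orders at the trivalent vertices and the cyclic order of the legs on
the oriented Wilson loop. -/
def Iso (v w : FeynmanDiagram m p) : Prop :=
  ∃ f : v.H ≃ w.H, (∀ h, f (v.edge h) = w.edge (f h)) ∧ (∀ h, f (v.vert h) = w.vert (f h)) ∧
    ∃ k : ℕ, ∀ i, f (v.leg i) = w.leg ((finRotate p ^ k) i)

/-- Let `a`, `x`, `y` be the half-edges at a trivalent vertex of `S` and suppose that the other
half of the edge of `a` is the first leg of `S`.  `IsSplit S a x y T` says that `T` is obtained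
from `S` by removing that edge together with the trivalent vertex, and by attaching `x` and `y`
to the Wilson loop at the place of the first leg of `S`, first `x`, then `y`. -/
def IsSplit (S : FeynmanDiagram m (p + 1)) (a x y : S.H) (T : FeynmanDiagram m (p + 2)) : Prop :=
  ∃ f : T.H → S.H, Function.Injective f ∧ Set.range f = {a, S.edge a}ᶜ ∧
    (∀ h, f (T.edge h) = S.edge (f h)) ∧
    (∀ h, f h ≠ x → f h ≠ y → f (T.vert h) = S.vert (f h)) ∧
    f (T.leg 0) = x ∧ f (T.leg 1) = y ∧ ∀ i : Fin p, f (T.leg i.succ.succ) = S.leg i.succ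

/-- The STU relation `S = T - U`.  The half-edges at the trivalent vertex are, in cyclic order,
`a`, `b = vert a`, `c = vert b`; the edge of `a` ends at the first leg of `S`.  In `T` the order
on the oriented Wilson loop is `c`, `b`; in `U` it is `b`, `c`. -/
def IsSTU (S : FeynmanDiagram m (p + 1)) (T U : FeynmanDiagram m (p + 2)) : Prop :=
  ∃ a : S.H, S.vert a ≠ a ∧ S.edge a = S.leg 0 ∧
    S.IsSplit a (S.vert (S.vert a)) (S.vert a) T ∧ S.IsSplit a (S.vert a) (S.vert (S.vert a)) U

end FeynmanDiagram

/-- The free complex vector space on broken, labelled Feynman diagrams with `2 * m` vertices. -/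
abbrev FreeDiagrams (m : ℕ) : Type 1 := (Σ p : ℕ, FeynmanDiagram m p) →₀ ℂ

/-- The subspace spanned by the differences of isomorphic diagrams and by the STU vectors. -/
noncomputable def diagramRelations (m : ℕ) : Submodule ℂ (FreeDiagrams m) :=
  Submodule.span ℂ
    ({r | ∃ (p : ℕ) (v w : FeynmanDiagram m p), v.Iso w ∧
        r = Finsupp.single ⟨p, v⟩ 1 - Finsupp.single ⟨p, w⟩ 1} ∪
     {r | ∃ (p : ℕ) (S : FeynmanDiagram m (p + 1)) (T U : FeynmanDiagram m (p + 2)),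
        S.IsSTU T U ∧
        r = Finsupp.single ⟨p + 1, S⟩ 1 - Finsupp.single ⟨p + 2, T⟩ 1
          + Finsupp.single ⟨p + 2, U⟩ 1})

/-- The space `𝒜_m`: Feynman diagrams with `2 * m` vertices modulo the STU relations. -/
abbrev DiagramSpace (m : ℕ) : Type 1 := FreeDiagrams m ⧸ diagramRelations m

namespace FeynmanDiagram

variable {m p : ℕ}

/-- The class of a Feynman diagram in `𝒜_m`. -/
noncomputable def toSpace (v : FeynmanDiagram m p) : DiagramSpace m :=
  (diagramRelations m).mkQ (Finsupp.single ⟨p, v⟩ 1)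

/-- The symmetrised diagram: the sum over all orderings of the legs on the Wilson loop. -/
noncomputable def sym (v : FeynmanDiagram m p) : DiagramSpace m :=
  ∑ σ : Equiv.Perm (Fin p), (v.permute σ).toSpace

/-- The lift of a diagram to the `n`-fold cyclic cover of the Wilson loop in which the `i`-th leg
is lifted to the sheet `s i`.  Running once around the covering circle, one meets the legs of
sheet `0`, then those of sheet `1`, and so on, within a sheet in their original order;
`Tuple.sort s` is this order (the stable sorting of `s`). -/
def lift {n : ℕ} (v : FeynmanDiagram m p) (s : Fin p → Fin n) : FeynmanDiagram m p :=
  v.permute (Tuple.sort s)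

end FeynmanDiagram

/-- `ψ` is the `n`-th cabling operator on `𝒜_m`: it maps every chord diagram to the sum over all
ways of lifting the ends of its chords to the `n` sheets of the `n`-fold cyclic cover. -/
def IsCabling (n m : ℕ) (ψ : DiagramSpace m →ₗ[ℂ] DiagramSpace m) : Prop :=
  ∀ (p : ℕ) (D : FeynmanDiagram m p), D.IsChordDiagram →
    ψ D.toSpace = ∑ s : Fin p → Fin n, (D.lift s).toSpace

/-! Summing over all lifts of the legs makes sense for every Feynman diagram, not only for chord
diagrams. `cableSum` is this sum, and it descends to `DiagramSpace m`. Moving the break only rotates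
the covering circle (`Iso.cableSum_eq`). In an STU relation, the lifts of `T` and `U` with the two
new ends on different sheets cancel in pairs, while those with both ends on one sheet differ by the
corresponding lift of `S` (`IsSTU.cableSum_eq`). The induced map `cabling` is a cabling operator,
and the only one, because STU resolves trivalent vertices until only chord diagrams remain
(`span_chordDiagrams`). The eigenvalue is then immediate (`cabling_sym`): each of the `n ^ p` lifts
merely permutes the legs, and a sum over all permutations absorbs this. -/

/-! ### Sorting permutations and cyclic translation of keys. -/

theorem Tuple.eq_sort_of_strictMono {p : ℕ} {k : Fin p → ℕ} {σ : Equiv.Perm (Fin p)}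
    (h : StrictMono (k ∘ σ)) : σ = Tuple.sort k :=
  Tuple.eq_sort_iff.2 ⟨h.monotone, fun _ _ hij he => absurd he (h hij).ne⟩

theorem Tuple.strictMono_comp_sort {p : ℕ} {k : Fin p → ℕ} (h : Function.Injective k) :
    StrictMono (k ∘ Tuple.sort k) :=
  (Tuple.monotone_sort k).strictMono_of_injective (h.comp (Tuple.sort k).injective)

theorem Tuple.sort_comp_perm {p : ℕ} {k : Fin p → ℕ} (h : Function.Injective k)
    (σ : Equiv.Perm (Fin p)) : σ * Tuple.sort (k ∘ σ) = Tuple.sort k :=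
  Tuple.eq_sort_of_strictMono (Tuple.strictMono_comp_sort (h.comp σ.injective))

/-- Translating the keys by one in a cycle of length `N` rotates the sorted order. -/
theorem Tuple.sort_add_one_mod {p N : ℕ} {k : Fin p → ℕ} (hk : Function.Injective k)
    (hN : ∀ i, k i < N) :
    ∃ j, Tuple.sort k = Tuple.sort (fun i => (k i + 1) % N) * finRotate p ^ j := by
  cases p with
  | zero => exact ⟨0, Subsingleton.elim _ _⟩
  | succ q =>
    set τ := Tuple.sort k with hτ
    have hmono : StrictMono (k ∘ τ) := Tuple.strictMono_comp_sort hk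
    -- Only the largest key can wrap around, and then it becomes `0`: the last point moves to the
    -- front and the order turns by one step.
    by_cases hl : k (τ (Fin.last q)) + 1 < N
    · refine ⟨0, ?_⟩
      rw [pow_zero, mul_one]
      apply Tuple.eq_sort_of_strictMono
      have hlt (i) : k (τ i) + 1 < N :=
        lt_of_le_of_lt (Nat.succ_le_succ (hmono.monotone (Fin.le_last i))) hl
      intro a b hab
      have : k (τ a) < k (τ b) := hmono hab
      simp only [Function.comp_apply, Nat.mod_eq_of_lt (hlt _)]
      omega
    · refine ⟨1, ?_⟩
      rw [pow_one, ← mul_inv_eq_iff_eq_mul]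
      apply Tuple.eq_sort_of_strictMono
      have hlast : k (τ (Fin.last q)) + 1 = N := by
        have := hN (τ (Fin.last q))
        omega
      have hlt (i : Fin q) : k (τ i.castSucc) + 1 < N := by
        have : k (τ i.castSucc) < k (τ (Fin.last q)) := hmono (Fin.castSucc_lt_last i)
        omega
      have h0 : (finRotate (q + 1))⁻¹ 0 = Fin.last q := by
        rw [Equiv.Perm.inv_eq_iff_eq, finRotate_last]
      have hs (i : Fin q) : (finRotate (q + 1))⁻¹ i.succ = i.castSucc := by
        rw [Equiv.Perm.inv_eq_iff_eq, finRotate_apply, Fin.coeSucc_eq_succ]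
      intro a b hab
      cases b using Fin.cases with
      | zero => exact absurd hab (Fin.not_lt_zero a)
      | succ b =>
        cases a using Fin.cases with
        | zero =>
          simp only [Function.comp_apply, Equiv.Perm.mul_apply, h0, hs, hlast, Nat.mod_self,
            Nat.mod_eq_of_lt (hlt _)]
          omega
        | succ a =>
          have : k (τ a.castSucc) < k (τ b.castSucc) :=
            hmono (Fin.castSucc_lt_castSucc_iff.2 (Fin.succ_lt_succ_iff.1 hab))
          simp only [Function.comp_apply, Equiv.Perm.mul_apply, hs, Nat.mod_eq_of_lt (hlt _)]
          omega

/-! ### Positions on the covering circle. -/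

/-- The position of the lift of the `i`-th point to the sheet `s i`, on a covering circle whose
sheets carry `p` points each. -/
def sheetKey {p n : ℕ} (s : Fin p → Fin n) (i : Fin p) : ℕ := (s i : ℕ) * p + i

theorem sheetKey_lt {p n : ℕ} (s : Fin p → Fin n) (i : Fin p) : sheetKey s i < n * p := by
  have h1 := (s i).isLt
  have h2 := i.isLt
  have : ((s i : ℕ) + 1) * p ≤ n * p := Nat.mul_le_mul_right p h1
  unfold sheetKey
  rw [Nat.add_mul] at this
  omega

theorem sheetKey_injective {p n : ℕ} (s : Fin p → Fin n) : Function.Injective (sheetKey s) := by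
  intro i j h
  have h' : sheetKey s i % p = sheetKey s j % p := by rw [h]
  simpa [sheetKey, Nat.add_mod, Nat.mod_eq_of_lt i.isLt, Nat.mod_eq_of_lt j.isLt, Fin.ext_iff]
    using h'

/-- The key encodes the pair (sheet, index) lexicographically, which is the order of a stable sort.
Unlike `s`, the key is injective and can be translated cyclically. -/
theorem sort_sheetKey {p n : ℕ} (s : Fin p → Fin n) : Tuple.sort (sheetKey s) = Tuple.sort s := by
  rw [Tuple.eq_sort_iff]
  have hmono := Tuple.strictMono_comp_sort (sheetKey_injective s)
  set τ := Tuple.sort (sheetKey s)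
  refine ⟨fun a b hab => ?_, fun a b hab he => ?_⟩
  · by_contra! hlt
    have h1 : (s (τ b) : ℕ) + 1 ≤ s (τ a) := hlt
    have h2 := Nat.mul_le_mul_right p h1
    have h3 : sheetKey s (τ a) ≤ sheetKey s (τ b) := hmono.monotone hab
    have h4 := (τ b).isLt
    simp only [sheetKey, Nat.add_mul] at h2 h3
    omega
  · have h : sheetKey s (τ a) < sheetKey s (τ b) := hmono hab
    simpa [sheetKey, he] using h

/-- Exchanging the first two entries, if distinct, commutes with sorting. -/
theorem Tuple.swap_mul_sort {p n : ℕ} {s : Fin (p + 2) → Fin n} (h : s 0 ≠ s 1) :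
    Equiv.swap 0 1 * Tuple.sort s = Tuple.sort (s ∘ Equiv.swap 0 1) := by
  rw [Tuple.eq_sort_iff]
  have hs := (Tuple.eq_sort_iff (f := s)).1 rfl
  set τ := Tuple.sort s
  refine ⟨fun a b hab => by simpa using hs.1 hab, fun a b hab he => ?_⟩
  simp only [Function.comp_apply, Equiv.Perm.mul_apply, Equiv.swap_apply_self] at he ⊢
  have hlt := hs.2 a b hab he
  generalize τ a = x at *
  generalize τ b = y at *
  -- The transposition reverses no inequality `x < y` other than `0 < 1`; here `x` and `y` lie on
  -- the same sheet, which excludes that pair.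
  have hne : ¬ (x = 0 ∧ y = 1) := by
    rintro ⟨rfl, rfl⟩
    exact h he
  simp only [Equiv.swap_apply_def]
  rw [Fin.lt_def] at hlt ⊢
  split_ifs <;> simp only [Fin.ext_iff, Fin.val_zero, Fin.val_one] at * <;> omega

/-- The extension of a permutation by a fixed point in front. -/
def Equiv.Perm.extendZero {p : ℕ} (σ : Equiv.Perm (Fin p)) : Equiv.Perm (Fin (p + 1)) :=
  Equiv.Perm.decomposeFin.symm (0, σ)

@[simp]
theorem Equiv.Perm.extendZero_zero {p : ℕ} (σ : Equiv.Perm (Fin p)) : σ.extendZero 0 = 0 := by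
  simp [Equiv.Perm.extendZero]

@[simp]
theorem Equiv.Perm.extendZero_succ {p : ℕ} (σ : Equiv.Perm (Fin p)) (i : Fin p) :
    σ.extendZero i.succ = (σ i).succ := by
  simp [Equiv.Perm.extendZero]

/-- The first leg on the lowest sheet wins every tie, so it stays next to the break, where STU
applies. -/
theorem Tuple.sort_cons_zero {p n : ℕ} [NeZero n] (s : Fin p → Fin n) :
    Tuple.sort (Fin.cons 0 s : Fin (p + 1) → Fin n) = (Tuple.sort s).extendZero := by
  symm
  rw [Tuple.eq_sort_iff]
  have hs := (Tuple.eq_sort_iff (f := s)).1 rfl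
  refine ⟨fun a b hab => ?_, fun a b hab he => ?_⟩
  · cases a using Fin.cases with
    | zero => simp
    | succ a =>
      cases b using Fin.cases with
      | zero => exact absurd hab (by simp)
      | succ b => simpa using hs.1 (Fin.succ_le_succ_iff.1 hab)
  · cases b using Fin.cases with
    | zero => exact absurd hab (Fin.not_lt_zero a)
    | succ b =>
      cases a using Fin.cases with
      | zero => simp
      | succ a => simpa using hs.2 a b (by simpa using hab) (by simpa using he)

/-- A deck transformation is a rotation of the covering circle by `c` sheets of `p` points each. -/
theorem sheetKey_add_const {p n : ℕ} [NeZero n] (s : Fin p → Fin n) (c : Fin n) (i : Fin p) :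
    sheetKey (fun i => s i + c) i = (sheetKey s i + c * p) % (n * p) := by
  have h : sheetKey s i + c * p = p * (s i + c) + i := by unfold sheetKey; ring
  have hp : 0 < p := i.pos
  rw [h, mul_comm n p, Nat.mod_mul, Nat.mul_add_mod, Nat.mod_eq_of_lt i.isLt, Nat.mul_add_div hp,
    Nat.div_eq_of_lt i.isLt, sheetKey, Fin.val_add, add_zero, mul_comm p, add_comm]

/-- The choice of sheets after moving the break of the Wilson loop past its last point. -/
def rotateSheets {p n : ℕ} [NeZero n] :
    (Fin (p + 1) → Fin n) ≃ (Fin (p + 1) → Fin n) :=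
  ((finRotate (p + 1)).arrowCongr (Equiv.refl _)).trans (Equiv.addRight (Pi.single 0 1))

theorem sheetKey_rotateSheets {p n : ℕ} [NeZero n] (s : Fin (p + 1) → Fin n) (i : Fin (p + 1)) :
    sheetKey (rotateSheets s) i =
      (sheetKey s ((finRotate (p + 1))⁻¹ i) + 1) % (n * (p + 1)) := by
  cases i using Fin.cases with
  | zero =>
    have h0 : (finRotate (p + 1))⁻¹ 0 = Fin.last p := by
      rw [Equiv.Perm.inv_eq_iff_eq, finRotate_last]
    have h1 : rotateSheets s 0 = s (Fin.last p) + 1 := by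
      rw [← h0]
      simp [rotateSheets, Equiv.arrowCongr, Equiv.Perm.inv_def]
    -- The successor of the last place of a sheet is the first place of the next one.
    have h2 : sheetKey s (Fin.last p) + 1 = (s (Fin.last p) + 1) * (p + 1) := by
      simp [sheetKey]; ring
    rw [h0, h2, Nat.mul_mod_mul_right, sheetKey, h1, Fin.val_add]
    simp [Nat.add_mod]
  | succ i =>
    have hs : (finRotate (p + 1))⁻¹ i.succ = i.castSucc := by
      rw [Equiv.Perm.inv_eq_iff_eq, finRotate_apply, Fin.coeSucc_eq_succ]
    have h1 : rotateSheets s i.succ = s i.castSucc := by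
      rw [← hs]
      simp [rotateSheets, Equiv.arrowCongr, Equiv.Perm.inv_def]
    have h2 : sheetKey s i.castSucc + 1 = sheetKey (rotateSheets s) i.succ := by
      simp only [sheetKey, h1, Fin.val_succ, Fin.val_castSucc]; ring
    rw [hs, h2, Nat.mod_eq_of_lt (sheetKey_lt _ _)]

theorem Fin.sum_pi_cons {ι M : Type*} [Fintype ι] [AddCommMonoid M] {p : ℕ}
    (F : (Fin (p + 1) → ι) → M) :
    ∑ s, F s = ∑ a, ∑ t : Fin p → ι, F (Fin.cons a t) := by
  rw [← Equiv.sum_comp (Fin.consEquiv fun _ => ι) F, Fintype.sum_prod_type]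
  rfl

/-! ### Invariance of the sum of lifts under isomorphism and STU. -/

namespace FeynmanDiagram

variable {m p : ℕ}

theorem permute_permute (v : FeynmanDiagram m p) (σ τ : Equiv.Perm (Fin p)) :
    (v.permute σ).permute τ = v.permute (σ * τ) := rfl

theorem permute_one (v : FeynmanDiagram m p) : v.permute 1 = v := rfl

theorem toSpace_eq_of_iso {v w : FeynmanDiagram m p} (h : v.Iso w) : v.toSpace = w.toSpace :=
  (Submodule.Quotient.eq _).2 (Submodule.subset_span (Or.inl ⟨p, v, w, h, rfl⟩))

theorem IsSTU.toSpace_eq {S : FeynmanDiagram m (p + 1)} {T U : FeynmanDiagram m (p + 2)}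
    (h : S.IsSTU T U) : S.toSpace = T.toSpace - U.toSpace := by
  have hmem : Finsupp.single ⟨p + 1, S⟩ 1 - Finsupp.single ⟨p + 2, T⟩ 1
      + Finsupp.single ⟨p + 2, U⟩ 1 ∈ diagramRelations m :=
    Submodule.subset_span (Or.inr ⟨p, S, T, U, h, rfl⟩)
  have h0 := (Submodule.Quotient.mk_eq_zero _).2 hmem
  rw [Submodule.Quotient.mk_add, Submodule.Quotient.mk_sub] at h0
  rw [eq_sub_iff_add_eq, ← sub_eq_zero, ← h0]
  simp only [toSpace, Submodule.mkQ_apply]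
  abel

/-- Isomorphy of broken diagrams, the break being preserved. -/
def BasedIso (v w : FeynmanDiagram m p) : Prop :=
  ∃ f : v.H ≃ w.H, (∀ h, f (v.edge h) = w.edge (f h)) ∧ (∀ h, f (v.vert h) = w.vert (f h)) ∧
    ∀ i, f (v.leg i) = w.leg i

theorem BasedIso.permute {v w : FeynmanDiagram m p} (h : v.BasedIso w)
    (σ : Equiv.Perm (Fin p)) : (v.permute σ).BasedIso (w.permute σ) := by
  obtain ⟨f, he, hv, hl⟩ := h
  exact ⟨f, he, hv, fun i => hl (σ i)⟩

theorem BasedIso.toSpace_eq {v w : FeynmanDiagram m p} (h : v.BasedIso w) :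
    v.toSpace = w.toSpace := by
  obtain ⟨f, he, hv, hl⟩ := h
  exact toSpace_eq_of_iso ⟨f, he, hv, 0, hl⟩

theorem Iso.exists_basedIso {v w : FeynmanDiagram m p} (h : v.Iso w) :
    ∃ k, v.BasedIso (w.permute (finRotate p ^ k)) := by
  obtain ⟨f, he, hv, k, hl⟩ := h
  exact ⟨k, f, he, hv, hl⟩

theorem toSpace_permute_mul_finRotate_pow (v : FeynmanDiagram m p) (σ : Equiv.Perm (Fin p))
    (k : ℕ) : (v.permute (σ * finRotate p ^ k)).toSpace = (v.permute σ).toSpace :=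
  toSpace_eq_of_iso ⟨Equiv.refl _, fun _ => rfl, fun _ => rfl, k, fun _ => rfl⟩

/-- The class of a diagram does not change when the keys sorting its legs are translated in a
cycle. -/
theorem toSpace_permute_sort_add_mod (v : FeynmanDiagram m p) {N : ℕ} {k : Fin p → ℕ}
    (hk : Function.Injective k) (hN : ∀ i, k i < N) (c : ℕ) :
    (v.permute (Tuple.sort fun i => (k i + c) % N)).toSpace =
      (v.permute (Tuple.sort k)).toSpace := by
  induction c with
  | zero => simp only [add_zero, Nat.mod_eq_of_lt (hN _)]
  | succ c ih =>
    rw [← ih]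
    have hinj : Function.Injective fun i => (k i + c) % N := by
      intro i j h
      have h' : k i ≡ k j [MOD N] := Nat.ModEq.add_right_cancel' c h
      exact hk (h'.eq_of_lt_of_lt (hN i) (hN j))
    obtain ⟨j, hj⟩ := Tuple.sort_add_one_mod (N := N) hinj
      fun i => Nat.mod_lt _ (Nat.zero_lt_of_lt (hN i))
    rw [hj, toSpace_permute_mul_finRotate_pow]
    simp only [Nat.mod_add_mod, add_assoc]

variable {n : ℕ}

theorem lift_eq_permute_sheetKey (v : FeynmanDiagram m p) (s : Fin p → Fin n) :
    v.lift s = v.permute (Tuple.sort (sheetKey s)) := by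
  rw [sort_sheetKey, lift]

theorem toSpace_lift_add_const [NeZero n] (v : FeynmanDiagram m p) (s : Fin p → Fin n)
    (c : Fin n) : (v.lift fun i => s i + c).toSpace = (v.lift s).toSpace := by
  rw [lift_eq_permute_sheetKey, lift_eq_permute_sheetKey, funext (sheetKey_add_const s c)]
  exact v.toSpace_permute_sort_add_mod (sheetKey_injective s) (sheetKey_lt s) _

theorem toSpace_lift_rotateSheets [NeZero n] (v : FeynmanDiagram m (p + 1))
    (s : Fin (p + 1) → Fin n) :
    (v.lift (rotateSheets s)).toSpace = ((v.permute (finRotate (p + 1))).lift s).toSpace := by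
  have hinj := (sheetKey_injective s).comp (finRotate (p + 1))⁻¹.injective
  rw [lift_eq_permute_sheetKey, lift_eq_permute_sheetKey, funext (sheetKey_rotateSheets s),
    permute_permute]
  refine (v.toSpace_permute_sort_add_mod hinj (fun i => sheetKey_lt s _) 1).trans ?_
  rw [← Tuple.sort_comp_perm hinj (finRotate (p + 1))]
  simp [Function.comp_assoc, Equiv.Perm.inv_def]

/-- The sum of all lifts of a diagram to the `n`-fold cyclic cover. -/
noncomputable def cableSum (n : ℕ) (v : FeynmanDiagram m p) : DiagramSpace m :=
  ∑ s : Fin p → Fin n, (v.lift s).toSpace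

theorem cableSum_permute_finRotate [NeZero n] (v : FeynmanDiagram m p) :
    (v.permute (finRotate p)).cableSum n = v.cableSum n := by
  cases p with
  | zero => rfl
  | succ p =>
    unfold cableSum
    rw [← Equiv.sum_comp rotateSheets fun s => (v.lift s).toSpace]
    exact Finset.sum_congr rfl fun s _ => (v.toSpace_lift_rotateSheets s).symm

theorem cableSum_permute_finRotate_pow [NeZero n] (v : FeynmanDiagram m p) (k : ℕ) :
    (v.permute (finRotate p ^ k)).cableSum n = v.cableSum n := by
  induction k with
  | zero => rfl
  | succ k ih => rw [pow_succ, ← permute_permute, cableSum_permute_finRotate, ih]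

theorem BasedIso.cableSum_eq {v w : FeynmanDiagram m p} (h : v.BasedIso w) :
    v.cableSum n = w.cableSum n :=
  Finset.sum_congr rfl fun _ _ => (h.permute _).toSpace_eq

theorem Iso.cableSum_eq [NeZero n] {v w : FeynmanDiagram m p} (h : v.Iso w) :
    v.cableSum n = w.cableSum n := by
  obtain ⟨k, hk⟩ := h.exists_basedIso
  rw [hk.cableSum_eq, cableSum_permute_finRotate_pow]

theorem vert_leg (v : FeynmanDiagram m p) (i : Fin p) : v.vert (v.leg i) = v.leg i :=
  (v.leg_range _).2 ⟨i, rfl⟩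

theorem IsSplit.permute {S : FeynmanDiagram m (p + 1)} {T : FeynmanDiagram m (p + 2)}
    {a x y : S.H} (h : S.IsSplit a x y T) (σ : Equiv.Perm (Fin p)) :
    (S.permute σ.extendZero).IsSplit a x y (T.permute σ.extendZero.extendZero) := by
  obtain ⟨f, hf, hr, he, hv, h0, h1, hl⟩ := h
  refine ⟨f, hf, hr, he, hv, ?_, ?_, fun i => ?_⟩
  · simpa [FeynmanDiagram.permute] using h0
  · have : (1 : Fin (p + 2)) = Fin.succ 0 := rfl
    simp only [FeynmanDiagram.permute, Function.comp_apply, this, Equiv.Perm.extendZero_succ,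
      Equiv.Perm.extendZero_zero]
    exact h1
  · simpa [FeynmanDiagram.permute] using hl (σ i)

theorem IsSTU.permute {S : FeynmanDiagram m (p + 1)} {T U : FeynmanDiagram m (p + 2)}
    (h : S.IsSTU T U) (σ : Equiv.Perm (Fin p)) :
    (S.permute σ.extendZero).IsSTU (T.permute σ.extendZero.extendZero)
      (U.permute σ.extendZero.extendZero) := by
  obtain ⟨a, ha, he, hT, hU⟩ := h
  refine ⟨a, ha, ?_, hT.permute σ, hU.permute σ⟩
  change S.edge a = S.leg (σ.extendZero 0)
  rw [Equiv.Perm.extendZero_zero, he]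

/-- Both graphs embed onto the same half-edges of `S`; only the order of the two new legs differs.
-/
theorem IsSplit.basedIso_swap {S : FeynmanDiagram m (p + 1)} {T U : FeynmanDiagram m (p + 2)}
    {a x y : S.H} (hT : S.IsSplit a x y T) (hU : S.IsSplit a y x U) :
    U.BasedIso (T.permute (Equiv.swap 0 1)) := by
  obtain ⟨f, hf, hfr, hfe, hfv, hf0, hf1, hfl⟩ := hT
  obtain ⟨g, hg, hgr, hge, hgv, hg0, hg1, hgl⟩ := hU
  let e : U.H ≃ T.H := (Equiv.ofInjective g hg).trans
    ((Equiv.setCongr (hgr.trans hfr.symm)).trans (Equiv.ofInjective f hf).symm)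
  have hfe' (h : U.H) : f (e h) = g h :=
    Equiv.apply_ofInjective_symm hf ⟨g h, _⟩
  refine ⟨e, fun h => hf ?_, fun h => hf ?_, fun i => hf ?_⟩
  · change f (e (U.edge h)) = f (T.edge (e h))
    rw [hfe', hge, hfe, hfe']
  · change f (e (U.vert h)) = f (T.vert (e h))
    rw [hfe']
    -- `IsSplit` does not prescribe `vert` over `x` and `y`; there both diagrams have legs, which
    -- `vert` fixes.
    by_cases hx : g h = x
    · have h1 : h = U.leg 1 := hg (hx.trans hg1.symm)
      have h2 : e h = T.leg 0 := hf ((hfe' h).trans (hx.trans hf0.symm))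
      rw [h2, vert_leg, ← h2, hfe', h1, vert_leg]
    by_cases hy : g h = y
    · have h1 : h = U.leg 0 := hg (hy.trans hg0.symm)
      have h2 : e h = T.leg 1 := hf ((hfe' h).trans (hy.trans hf1.symm))
      rw [h2, vert_leg, ← h2, hfe', h1, vert_leg]
    rw [hgv h hy hx, hfv (e h) (by rwa [hfe']) (by rwa [hfe']), hfe']
  · change f (e (U.leg i)) = f (T.leg (Equiv.swap 0 1 i))
    rw [hfe']
    cases i using Fin.cases with
    | zero => rw [Equiv.swap_apply_left, hg0, hf1]
    | succ i =>
      cases i using Fin.cases with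
      | zero => exact hg1.trans (hf0.symm.trans (by rw [Fin.succ_zero_eq_one, Equiv.swap_apply_right]))
      | succ i =>
        rw [hgl, Equiv.swap_apply_of_ne_of_ne (Fin.succ_ne_zero _), hfl]
        simp [Fin.ext_iff]

theorem IsSTU.basedIso_swap {S : FeynmanDiagram m (p + 1)} {T U : FeynmanDiagram m (p + 2)}
    (h : S.IsSTU T U) : U.BasedIso (T.permute (Equiv.swap 0 1)) := by
  obtain ⟨a, -, -, hT, hU⟩ := h
  exact hT.basedIso_swap hU

theorem IsSTU.toSpace_lift_of_ne {S : FeynmanDiagram m (p + 1)} {T U : FeynmanDiagram m (p + 2)}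
    (h : S.IsSTU T U) {s : Fin (p + 2) → Fin n} (hs : s 0 ≠ s 1) :
    (U.lift (s ∘ Equiv.swap 0 1)).toSpace = (T.lift s).toSpace := by
  have hiso := (h.basedIso_swap.permute (Tuple.sort (s ∘ Equiv.swap 0 1))).toSpace_eq
  rw [permute_permute, ← Tuple.swap_mul_sort hs, Equiv.swap_mul_self_mul,
    Tuple.swap_mul_sort hs] at hiso
  exact hiso

/-- Translating all sheets by `-a` puts the split ends on sheet `0`. They then stay first and
adjacent, so the lifts again form an STU triple. -/
theorem IsSTU.toSpace_lift_of_eq [NeZero n] {S : FeynmanDiagram m (p + 1)}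
    {T U : FeynmanDiagram m (p + 2)} (h : S.IsSTU T U) (a : Fin n) (t : Fin p → Fin n) :
    (S.lift (Fin.cons a t)).toSpace =
      (T.lift (Fin.cons a (Fin.cons a t : Fin (p + 1) → Fin n))).toSpace -
        (U.lift (Fin.cons a (Fin.cons a t : Fin (p + 1) → Fin n))).toSpace := by
  have h1 : (fun i => (Fin.cons a t : Fin (p + 1) → Fin n) i + -a) =
      Fin.cons 0 (fun i => t i + -a) := by
    funext i
    cases i using Fin.cases <;> simp
  have h2 : (fun i => (Fin.cons a (Fin.cons a t : Fin (p + 1) → Fin n) : Fin (p + 2) → Fin n) i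
      + -a) = Fin.cons 0 (Fin.cons 0 (fun i => t i + -a) : Fin (p + 1) → Fin n) := by
    rw [← h1]
    funext i
    cases i using Fin.cases <;> simp
  rw [← S.toSpace_lift_add_const _ (-a), ← T.toSpace_lift_add_const _ (-a),
    ← U.toSpace_lift_add_const _ (-a), h1, h2]
  simp only [lift, Tuple.sort_cons_zero]
  exact (h.permute _).toSpace_eq

theorem IsSTU.cableSum_eq [NeZero n] {S : FeynmanDiagram m (p + 1)}
    {T U : FeynmanDiagram m (p + 2)} (h : S.IsSTU T U) :
    S.cableSum n = T.cableSum n - U.cableSum n := by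
  -- A lift of `T` is paired with the lift of `U` whose first two sheets are exchanged; only the
  -- diagonal `a = b` survives.
  have hterm (a b : Fin n) (t : Fin p → Fin n) :
      (T.lift (Fin.cons a (Fin.cons b t : Fin (p + 1) → Fin n))).toSpace -
        (U.lift (Fin.cons b (Fin.cons a t : Fin (p + 1) → Fin n))).toSpace =
      if a = b then (S.lift (Fin.cons a t)).toSpace else 0 := by
    split_ifs with hab
    · subst hab
      exact (h.toSpace_lift_of_eq a t).symm
    · rw [sub_eq_zero, ← h.toSpace_lift_of_ne (s := Fin.cons a (Fin.cons b t)) hab]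
      congr 2
      funext i
      cases i using Fin.cases with
      | zero => simp
      | succ i =>
        cases i using Fin.cases with
        | zero => simp
        | succ i =>
          rw [Function.comp_apply, Equiv.swap_apply_of_ne_of_ne (Fin.succ_ne_zero _)]
          · simp
          · simp [Fin.ext_iff]
  have hU : U.cableSum n = ∑ a, ∑ b, ∑ t : Fin p → Fin n,
      (U.lift (Fin.cons b (Fin.cons a t : Fin (p + 1) → Fin n))).toSpace := by
    rw [Finset.sum_comm, cableSum, Fin.sum_pi_cons]
    simp only [Fin.sum_pi_cons (p := p)]
  rw [hU, cableSum, cableSum, Fin.sum_pi_cons, Fin.sum_pi_cons]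
  simp only [Fin.sum_pi_cons (p := p), ← Finset.sum_sub_distrib, hterm]
  refine Finset.sum_congr rfl fun a _ => ?_
  rw [Finset.sum_comm]
  simp

end FeynmanDiagram

/-! ### The cabling operator and its eigenvectors. -/

/-- The `n`-th cabling operator. -/
noncomputable def cabling (n m : ℕ) [NeZero n] : DiagramSpace m →ₗ[ℂ] DiagramSpace m :=
  (diagramRelations m).liftQ
    (Finsupp.linearCombination ℂ fun x : Σ p, FeynmanDiagram m p => x.2.cableSum n) <| by
  refine Submodule.span_le.2 ?_
  rintro _ (⟨p, v, w, h, rfl⟩ | ⟨p, S, T, U, h, rfl⟩)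
  · simp [h.cableSum_eq]
  · simp [h.cableSum_eq]

theorem cabling_toSpace {n m p : ℕ} [NeZero n] (v : FeynmanDiagram m p) :
    cabling n m v.toSpace = v.cableSum n :=
  (Submodule.liftQ_apply _ _ _).trans (by simp)

theorem cabling_sym {n m p : ℕ} [NeZero n] (v : FeynmanDiagram m p) :
    cabling n m v.sym = (n : ℂ) ^ p • v.sym := by
  -- Lifting along `s` is right multiplication of `σ` by `Tuple.sort s`, a bijection of the
  -- symmetric group.
  have h (s : Fin p → Fin n) :
      ∑ σ : Equiv.Perm (Fin p), ((v.permute σ).lift s).toSpace = v.sym :=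
    Equiv.sum_comp (Equiv.mulRight (Tuple.sort s)) fun σ => (v.permute σ).toSpace
  simp only [FeynmanDiagram.sym, map_sum, cabling_toSpace, FeynmanDiagram.cableSum]
  rw [Finset.sum_comm]
  simp only [h, Finset.sum_const, Finset.card_univ, Fintype.card_pi, Fintype.card_fin,
    Finset.prod_const, FeynmanDiagram.sym]
  rw [← Nat.cast_smul_eq_nsmul ℂ, Nat.cast_pow]

/-! ### Counting half-edges and vertices. -/

theorem Equiv.Perm.sameCycle_iff_of_cube {H : Type*} {σ : Equiv.Perm H}
    (h3 : ∀ h, σ (σ (σ h)) = h) {x y : H} :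
    σ.SameCycle x y ↔ y = x ∨ y = σ x ∨ y = σ (σ x) := by
  constructor
  · rintro ⟨i, rfl⟩
    have h1 : σ ^ (3 : ℤ) = 1 := Equiv.ext fun h => h3 h
    have h2 : σ ^ i = σ ^ (i % 3) := by
      conv_lhs => rw [← Int.emod_add_mul_ediv i 3, zpow_add, zpow_mul, h1, one_zpow, mul_one]
    have h4 : i % 3 = 0 ∨ i % 3 = 1 ∨ i % 3 = 2 := by omega
    rw [h2]
    rcases h4 with h | h | h <;> rw [h]
    · exact Or.inl rfl
    · exact Or.inr (Or.inl rfl)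
    · exact Or.inr (Or.inr rfl)
  · rintro (rfl | rfl | rfl)
    · exact .refl _ _
    · exact ⟨1, rfl⟩
    · exact ⟨2, rfl⟩

/-- A permutation of order dividing three with `p` fixed points. -/
theorem Equiv.Perm.three_mul_card_orbits {H : Type*} [Finite H] {σ : Equiv.Perm H}
    (h3 : ∀ h, σ (σ (σ h)) = h) {p : ℕ} {leg : Fin p → H} (hleg : Function.Injective leg)
    (hrange : ∀ h, σ h = h ↔ ∃ i, leg i = h) :
    3 * Nat.card (Quotient (Equiv.Perm.SameCycle.setoid σ)) = Nat.card H + 2 * p := by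
  classical
  have := Fintype.ofFinite H
  let q : H → Quotient (Equiv.Perm.SameCycle.setoid σ) := Quotient.mk _
  have hq (x y : H) : q y = q x ↔ y = x ∨ y = σ x ∨ y = σ (σ x) :=
    eq_comm.trans <| Quotient.eq.trans (Equiv.Perm.sameCycle_iff_of_cube h3)
  have hp : (Finset.univ.filter fun h => σ h = h).card = p := by
    have : (Finset.univ.filter fun h => σ h = h) = Finset.univ.image leg := by
      ext h
      simp [hrange]
    rw [this, Finset.card_image_of_injective _ hleg, Finset.card_univ, Fintype.card_fin]
  rw [Nat.card_eq_fintype_card, Nat.card_eq_fintype_card, ← Finset.card_univ, ← Finset.card_univ,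
    Finset.card_eq_sum_card_fiberwise (f := q) (s := Finset.univ) (t := Finset.univ) (by simp),
    ← hp, Finset.card_eq_sum_card_fiberwise (f := q) (t := Finset.univ) (by simp),
    Finset.mul_sum, ← Finset.sum_add_distrib, mul_comm, ← smul_eq_mul, ← Finset.sum_const]
  -- Orbit by orbit: a fixed point gives `3 = 1 + 2`, a three-cycle gives `3 = 3 + 0`.
  refine Finset.sum_congr rfl fun b _ => ?_
  obtain ⟨x, rfl⟩ : ∃ x, q x = b := Quotient.exists_rep b
  by_cases hx : σ x = x
  · have h1 : (Finset.univ.filter fun h => q h = q x) = {x} := by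
      ext h
      simp [hq, hx]
    have h2 : ((Finset.univ.filter fun h => σ h = h).filter fun h => q h = q x) = {x} := by
      ext h
      simp only [Finset.mem_filter, Finset.mem_univ, true_and, hq, hx, or_self,
        Finset.mem_singleton, and_iff_right_iff_imp]
      rintro rfl
      exact hx
    rw [h1, h2, Finset.card_singleton, mul_one]
  · have hx2 : σ (σ x) ≠ σ x := fun h => hx (σ.injective h)
    have hx3 : σ (σ x) ≠ x := fun h => hx (by rw [← h, h3, h])
    have h1 : (Finset.univ.filter fun h => q h = q x) = {x, σ x, σ (σ x)} := by
      ext h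
      simp [hq]
    have h2 : ((Finset.univ.filter fun h => σ h = h).filter fun h => q h = q x) = ∅ := by
      refine Finset.filter_eq_empty_iff.2 fun h hh => ?_
      rw [Finset.mem_filter] at hh
      rw [hq]
      rintro (rfl | rfl | rfl)
      · exact hx hh.2
      · exact hx2 hh.2
      · exact hx2 (σ.injective hh.2)
    rw [h1, h2, Finset.card_empty, mul_zero, add_zero,
      Finset.card_eq_three.2 ⟨x, σ x, σ (σ x), Ne.symm hx, Ne.symm hx3, Ne.symm hx2, rfl⟩]

/-! ### Resolving trivalent vertices by STU. -/

namespace FeynmanDiagram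

variable {m p : ℕ}

theorem card_add_two_mul (v : FeynmanDiagram m p) : Nat.card v.H + 2 * p = 6 * m := by
  have := v.finite_H
  have h := Equiv.Perm.three_mul_card_orbits v.vert_vert_vert v.leg_injective v.leg_range
  rw [v.card_vertices] at h
  omega

/-- An edge joining a trivalent vertex to the Wilson loop can be removed as in the STU
relation. -/
theorem exists_isSplit (S : FeynmanDiagram m (p + 1)) {a x y : S.H} (ha : S.vert a ≠ a)
    (he : S.edge a = S.leg 0)
    (hxy : (x = S.vert a ∧ y = S.vert (S.vert a)) ∨ (x = S.vert (S.vert a) ∧ y = S.vert a)) :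
    ∃ T, S.IsSplit a x y T := by
  classical
  have := S.finite_H
  have h3 := S.vert_vert_vert
  have hea : S.vert (S.edge a) = S.edge a := by rw [he, vert_leg]
  have hva : S.vert (S.vert a) ≠ S.vert a := fun h => ha (S.vert.injective h)
  have hvva : S.vert (S.vert a) ≠ a := fun h => ha (by rw [← h, h3, h])
  have hmem (h : S.H) : (h = x ∨ h = y) ↔ (h = S.vert a ∨ h = S.vert (S.vert a)) := by
    rcases hxy with ⟨rfl, rfl⟩ | ⟨rfl, rfl⟩
    · rfl
    · exact or_comm
  have hxney : x ≠ y := by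
    rcases hxy with ⟨rfl, rfl⟩ | ⟨rfl, rfl⟩
    · exact hva.symm
    · exact hva
  have hva_ne (h : S.H) (hh : h = x ∨ h = y) : h ≠ a ∧ S.vert h ≠ h := by
    rcases (hmem h).1 hh with rfl | rfl
    · exact ⟨ha, hva⟩
    · exact ⟨hvva, fun h => hva (S.vert.injective h)⟩
  have hne (h : S.H) (hh : h = x ∨ h = y) : h ≠ a ∧ h ≠ S.edge a :=
    ⟨(hva_ne h hh).1, fun h' => (hva_ne h hh).2 (by rw [h', hea])⟩
  have hkeep (h : S.H) (hh : ¬ (h = x ∨ h = y)) (h1 : h ≠ a ∧ h ≠ S.edge a) :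
      ¬ (S.vert h = x ∨ S.vert h = y) ∧ S.vert h ≠ a ∧ S.vert h ≠ S.edge a := by
    rw [hmem, not_or] at hh ⊢
    refine ⟨⟨fun h' => h1.1 (S.vert.injective h'), fun h' => hh.1 (S.vert.injective h')⟩,
      fun h' => hh.2 (by rw [← h', h3]), fun h' => h1.2 (S.vert.injective (by rw [h', hea]))⟩
  let K := {h : S.H // h ≠ a ∧ h ≠ S.edge a}
  -- The new vertex permutation makes `x` and `y` univalent and is `S.vert` elsewhere.
  let g : K → K := fun h =>
    if hh : h.1 = x ∨ h.1 = y then h else ⟨S.vert h.1, (hkeep h.1 hh h.2).2⟩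
  have hg1 (h : K) (hh : h.1 = x ∨ h.1 = y) : g h = h := dif_pos hh
  have hg2 (h : K) (hh : ¬ (h.1 = x ∨ h.1 = y)) : (g h).1 = S.vert h.1 := by
    simp only [g, dif_neg hh]
  have hg3 (h : K) : g (g (g h)) = h := by
    by_cases hh : h.1 = x ∨ h.1 = y
    · rw [hg1 h hh, hg1 h hh, hg1 h hh]
    · have k1 := hkeep h.1 hh h.2
      have k2 := hkeep _ k1.1 k1.2
      have e1 := hg2 h hh
      have e2 := hg2 (g h) (by rw [e1]; exact k1.1)
      have e3 := hg2 (g (g h)) (by rw [e2, e1]; exact k2.1)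
      exact Subtype.ext (by rw [e3, e2, e1, h3])
  have hlegne (i : Fin p) : S.leg i.succ ≠ a ∧ S.leg i.succ ≠ S.edge a := by
    refine ⟨fun h => ha (by rw [← h, vert_leg]), fun h => ?_⟩
    rw [he] at h
    exact Fin.succ_ne_zero i (S.leg_injective h)
  let L : Fin (p + 2) → K := Fin.cons ⟨x, hne x (Or.inl rfl)⟩
    (Fin.cons ⟨y, hne y (Or.inr rfl)⟩ fun i => ⟨S.leg i.succ, hlegne i⟩ : Fin (p + 1) → K)
  have hlegxy (i : Fin p) : ¬ (S.leg i.succ = x ∨ S.leg i.succ = y) := fun h =>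
    (hva_ne _ h).2 (vert_leg S _)
  have hLinj : Function.Injective L := by
    refine Fin.cons_injective_iff.2 ⟨?_, Fin.cons_injective_iff.2 ⟨?_, fun i j h => ?_⟩⟩
    · rintro ⟨i, hi⟩
      cases i using Fin.cases with
      | zero => exact hxney (Subtype.ext_iff.1 hi).symm
      | succ i => exact hlegxy i (Or.inl (Subtype.ext_iff.1 hi))
    · rintro ⟨i, hi⟩
      exact hlegxy i (Or.inr (Subtype.ext_iff.1 hi))
    · exact Fin.succ_injective _ (S.leg_injective (Subtype.ext_iff.1 h))
  have hLrange (h : K) : g h = h ↔ ∃ i, L i = h := by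
    constructor
    · intro hh
      by_cases hc : h.1 = x ∨ h.1 = y
      · rcases hc with hc | hc
        · exact ⟨0, Subtype.ext hc.symm⟩
        · exact ⟨1, Subtype.ext hc.symm⟩
      · obtain ⟨i, hi⟩ := (S.leg_range h.1).1 (by rw [← hg2 h hc, hh])
        cases i using Fin.cases with
        | zero => exact absurd (hi.symm.trans he.symm) h.2.2
        | succ i => exact ⟨i.succ.succ, Subtype.ext hi⟩
    · rintro ⟨i, rfl⟩
      cases i using Fin.cases with
      | zero => exact hg1 _ (Or.inl rfl)
      | succ i =>
        cases i using Fin.cases with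
        | zero => exact hg1 _ (Or.inr rfl)
        | succ i => exact Subtype.ext ((hg2 _ (hlegxy i)).trans (S.vert_leg _))
  let V : Equiv.Perm K := ⟨g, g ∘ g, hg3, hg3⟩
  have hedge (h : S.H) : (h ≠ a ∧ h ≠ S.edge a) ↔ (S.edge h ≠ a ∧ S.edge h ≠ S.edge a) := by
    rw [S.edge.injective.ne_iff, and_comm]
    refine and_congr_left fun _ => not_congr ⟨fun h' => ?_, fun h' => ?_⟩
    · rw [h', S.edge_edge]
    · rw [← h', S.edge_edge]
  let E : Equiv.Perm K := S.edge.subtypePerm fun h => (hedge h).symm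
  have hcard : Nat.card K + 2 = Nat.card S.H := by
    have h1 := Set.ncard_add_ncard_compl ({a, S.edge a} : Set S.H)
    rw [Set.ncard_pair (S.edge_ne a).symm, ← Nat.card_coe_set_eq] at h1
    rw [← h1, add_comm]
    congr 1
    exact Nat.card_congr (Equiv.subtypeEquivRight fun h => by simp)
  -- Two half-edges are lost and one leg is gained, so half-edges plus twice the legs, hence the
  -- number of vertices, is unchanged.
  have hvert : Nat.card (Quotient (Equiv.Perm.SameCycle.setoid V)) = 2 * m := by
    have h1 := Equiv.Perm.three_mul_card_orbits (σ := V) hg3 hLinj hLrange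
    have h2 := S.card_add_two_mul
    omega
  -- A path to a leg of `S` can leave `K` only from `x` or `y`, and these are now legs themselves.
  have hatt (h : S.H) (i : Fin (p + 1))
      (hi : Relation.ReflTransGen (fun x y => y = S.edge x ∨ y = S.vert x) h (S.leg i)) :
      ∀ hK : h ≠ a ∧ h ≠ S.edge a,
        ∃ j, Relation.ReflTransGen (fun x y => y = E x ∨ y = V x) (⟨h, hK⟩ : K) (L j) := by
    induction hi using Relation.ReflTransGen.head_induction_on with
    | refl =>
      intro hK
      cases i using Fin.cases with
      | zero => exact absurd he.symm hK.2
      | succ i => exact ⟨i.succ.succ, .refl⟩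
    | head hstep hpath ih =>
      rename_i u w
      intro hK
      by_cases hc : u = x ∨ u = y
      · obtain ⟨j, hj⟩ := (hLrange ⟨u, hK⟩).1 (hg1 _ hc)
        exact ⟨j, by rw [hj]⟩
      · rcases hstep with rfl | rfl
        · obtain ⟨j, hj⟩ := ih ((hedge u).1 hK)
          exact ⟨j, hj.head (Or.inl rfl)⟩
        · obtain ⟨j, hj⟩ := ih (hkeep u hc hK).2
          exact ⟨j, hj.head (Or.inr (Subtype.ext (hg2 ⟨u, hK⟩ hc).symm))⟩
  let T : FeynmanDiagram m (p + 2) :=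
    { H := K
      finite_H := inferInstance
      edge := E
      edge_edge := fun h => Subtype.ext (S.edge_edge h.1)
      edge_ne := fun h hh => S.edge_ne h.1 (Subtype.ext_iff.1 hh)
      vert := V
      vert_vert_vert := hg3
      card_vertices := hvert
      leg := L
      leg_injective := hLinj
      leg_range := hLrange
      attached := fun h => by
        obtain ⟨i, hi⟩ := S.attached h.1
        exact hatt h.1 i hi h.2 }
  refine ⟨T, Subtype.val, Subtype.val_injective, ?_, fun _ => rfl,
    fun h h1 h2 => hg2 h (not_or.2 ⟨h1, h2⟩), rfl, rfl, fun _ => rfl⟩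
  rw [Subtype.range_coe_subtype]
  ext h
  simp

theorem exists_isSTU (S : FeynmanDiagram m (p + 1)) {a : S.H} (ha : S.vert a ≠ a)
    (he : S.edge a = S.leg 0) : ∃ T U, S.IsSTU T U := by
  obtain ⟨T, hT⟩ := S.exists_isSplit ha he (Or.inr ⟨rfl, rfl⟩)
  obtain ⟨U, hU⟩ := S.exists_isSplit ha he (Or.inl ⟨rfl, rfl⟩)
  exact ⟨T, U, a, ha, he, hT, hU⟩

/-- A diagram with a trivalent vertex has a trivalent vertex next to the Wilson loop. -/
theorem exists_edge_eq_leg (v : FeynmanDiagram m p) (hv : ¬ v.IsChordDiagram) :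
    ∃ a i, v.vert a ≠ a ∧ v.edge a = v.leg i := by
  obtain ⟨h, hh⟩ := not_forall.1 hv
  obtain ⟨i, hi⟩ := v.attached h
  induction hi using Relation.ReflTransGen.head_induction_on with
  | refl => exact absurd (v.vert_leg i) hh
  | head hstep hpath ih =>
    rename_i u w
    -- Along a path to a leg, the first passage to a univalent vertex must cross an edge, since
    -- `vert` preserves the valence.
    by_cases hw : v.vert w = w
    · rcases hstep with rfl | rfl
      · obtain ⟨j, hj⟩ := (v.leg_range _).1 hw
        exact ⟨u, j, hh, hj.symm⟩
      · exact absurd (v.vert.injective hw) hh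
    · exact ih hw

theorem exists_finRotate_pow_zero (i : Fin (p + 1)) : ∃ k, (finRotate (p + 1) ^ k) 0 = i := by
  refine ⟨i, ?_⟩
  induction i using Fin.induction with
  | zero => rfl
  | succ i ih =>
    rw [Fin.val_succ, pow_succ', Equiv.Perm.mul_apply]
    rw [Fin.val_castSucc] at ih
    rw [ih, finRotate_apply, Fin.coeSucc_eq_succ]

/-- Induction on the number of half-edges, equal to `6 * m - 2 * p`: each STU step adds a leg. The
break is first moved so that the edge to be removed ends at leg `0`. -/
theorem toSpace_mem_span_chordDiagrams (v : FeynmanDiagram m p) :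
    v.toSpace ∈ Submodule.span ℂ
      {x | ∃ (q : ℕ) (D : FeynmanDiagram m q), D.IsChordDiagram ∧ x = D.toSpace} := by
  induction hN : Nat.card v.H using Nat.strong_induction_on generalizing p with
  | _ N ih =>
    by_cases hv : v.IsChordDiagram
    · exact Submodule.subset_span ⟨p, v, hv, rfl⟩
    obtain ⟨a, i, ha, hi⟩ := v.exists_edge_eq_leg hv
    cases p with
    | zero => exact i.elim0
    | succ p =>
      obtain ⟨k, hk⟩ := exists_finRotate_pow_zero i
      have hrot : (v.permute (finRotate (p + 1) ^ k)).toSpace = v.toSpace := by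
        simpa only [one_mul, permute_one] using v.toSpace_permute_mul_finRotate_pow 1 k
      obtain ⟨T, U, h⟩ := (v.permute (finRotate (p + 1) ^ k)).exists_isSTU (a := a) ha
        (hi.trans (congrArg v.leg hk.symm))
      rw [← hrot, h.toSpace_eq]
      have hc := v.card_add_two_mul
      have hcT := T.card_add_two_mul
      have hcU := U.card_add_two_mul
      exact Submodule.sub_mem _ (ih _ (by omega) T rfl) (ih _ (by omega) U rfl)

end FeynmanDiagram

/-! ### Uniqueness and conclusion. -/

theorem span_chordDiagrams (m : ℕ) :
    Submodule.span ℂ {x : DiagramSpace m | ∃ (q : ℕ) (D : FeynmanDiagram m q),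
      D.IsChordDiagram ∧ x = D.toSpace} = ⊤ := by
  refine eq_top_iff.2 fun x _ => ?_
  obtain ⟨x, rfl⟩ := Submodule.mkQ_surjective _ x
  induction x using Finsupp.induction_linear with
  | zero => simp
  | add f g hf hg =>
    rw [map_add]
    exact Submodule.add_mem _ (hf trivial) (hg trivial)
  | single v c =>
    rw [← mul_one c, ← smul_eq_mul, ← Finsupp.smul_single, map_smul]
    exact Submodule.smul_mem _ c v.2.toSpace_mem_span_chordDiagrams

theorem isCabling_cabling (n m : ℕ) [NeZero n] : IsCabling n m (cabling n m) :=
  fun _ D _ => cabling_toSpace D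

theorem IsCabling.eq_cabling {n m : ℕ} [NeZero n] {ψ : DiagramSpace m →ₗ[ℂ] DiagramSpace m}
    (h : IsCabling n m ψ) : ψ = cabling n m := by
  refine LinearMap.ext_on (span_chordDiagrams m) ?_
  rintro _ ⟨q, D, hD, rfl⟩
  rw [h q D hD, isCabling_cabling n m q D hD]

theorem theorem3 (n m : ℕ) (hn : 1 ≤ n) :
    (∃! ψ : DiagramSpace m →ₗ[ℂ] DiagramSpace m, IsCabling n m ψ) ∧
    ∀ ψ : DiagramSpace m →ₗ[ℂ] DiagramSpace m, IsCabling n m ψ →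
      ∀ (p : ℕ) (v : FeynmanDiagram m p), ψ v.sym = (n : ℂ) ^ p • v.sym := by
  have : NeZero n := ⟨Nat.one_le_iff_ne_zero.1 hn⟩
  refine ⟨⟨cabling n m, isCabling_cabling n m, fun _ h => h.eq_cabling⟩, fun ψ h p v => ?_⟩
  rw [h.eq_cabling, cabling_sym]
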